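/- Let $K$ be a field. A weighted oriented graph $D_G$ with underlying finite simple graph $G$ is an orientation of $G$ together with a weight function $w:V(G)\to\mathbb{N}\setminus\{0\}$; its edge ideal is $I(D_G)=\langle\, x\,y^{w(y)} \mid (x,y)\in E(D_G)\,\rangle$ in the polynomial ring over $K$ whose variables are the vertices of $G$, where $(x,y)$ denotes an edge directed from $x$ to $y$. One says that $D_G$ is Cohen--Macaulay if the quotient of this polynomial ring by $I(D_G)$ is a Cohen--Macaulay ring. For a set $S$ of vertices, $D_G\setminus S$ is obtained from $D_G$ by deleting $S$ and all edges meeting $S$ and keeping the remaining weights and directions. **Proposition.** Let $D_H$ be a weighted oriented graph with vertex set $\{x_1,\ldots,x_n,z\}$, let $x_1,\ldots,x_k$ be the vertices adjacent to $z$, and assume $(x_i,z)\in E(D_H)$ for $i=1,\ldots,k$. Put $D_G=D_H\setminus\{z\}$ and $D_F=D_G\setminus\{x_1,\ldots,x_k\}$. Assume that $\{x_1,\ldots,x_k\}$ is not contained in any minimal vertex cover of $G$ and that, in $K[x_1,\ldots,x_n]$, $$\operatorname{ht}\langle I(D_G),x_1,\ldots,x_k\rangle=\operatorname{ht} I(D_G)+1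 .$$ If $D_F$ and $D_G$ are Cohen--Macaulay, then $D_H$ is Cohen--Macaulay. -/

import Mathlib

universe u v

/-- A weighted oriented graph on the vertex set `V`: an orientation of a simple graph (so there are
no loops, and an edge carries exactly one direction) together with positive integer weights on the
vertices. `D.Edge x y` means that `(x, y)` is an edge, directed from `x` to `y`. -/
structure WeightedOrientedGraph (V : Type u) where
  Edge : V → V → Prop
  asymm : ∀ ⦃x y : V⦄, Edge x y → ¬ Edge y x
  weight : V → ℕ
  weight_pos : ∀ x : V, 0 < weight x

namespace WeightedOrientedGraph

variable {V : Type u}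

/-- The underlying simple graph, obtained by forgetting weights and directions. -/
def underlying (D : WeightedOrientedGraph V) : SimpleGraph V where
  Adj x y := D.Edge x y ∨ D.Edge y x
  symm := ⟨fun _ _ h => h.symm⟩
  loopless := ⟨fun _ h => h.elim (fun e => D.asymm e e) (fun e => D.asymm e e)⟩

/-- The weighted oriented graph `D \ s`: delete the vertices in `s` and all edges meeting `s`, and
keep the weights and the directions of the remaining edges. -/
def deleteVerts (D : WeightedOrientedGraph V) (s : Set V) :
    WeightedOrientedGraph {x : V // x ∉ s} where
  Edge x y := D.Edge x.1 y.1
  asymm _ _ h := D.asymm h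
  weight x := D.weight x.1
  weight_pos x := D.weight_pos x.1

/-- The edge ideal, generated by the monomials `x * y ^ w(y)` over all directed edges `(x, y)`, in
the polynomial ring over `K` whose variables are the vertices. -/
noncomputable def edgeIdeal (D : WeightedOrientedGraph V) (K : Type v) [Field K] :
    Ideal (MvPolynomial V K) :=
  Ideal.span {f | ∃ x y : V, D.Edge x y ∧
    f = MvPolynomial.X x * MvPolynomial.X y ^ D.weight y}

end WeightedOrientedGraph

/-- The grade of an ideal `I` of a commutative ring `R`: the supremum of the lengths of the
`R`-regular sequences contained in `I`. For a maximal ideal `m` of a Noetherian ring it is the depth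
of the local ring `R_m`. -/
noncomputable def idealGrade {R : Type*} [CommRing R] (I : Ideal R) : ℕ∞ :=
  ⨆ (rs : List R) (_ : (∀ r ∈ rs, r ∈ I) ∧ RingTheory.Sequence.IsRegular R rs), (rs.length : ℕ∞)

/-- A commutative ring `R` is Cohen-Macaulay if it is Noetherian and the grade of every maximal
ideal `m` is equal to its height (that is, `depth R_m = dim R_m` for every maximal ideal `m`). -/
def IsCohenMacaulayRing (R : Type*) [CommRing R] : Prop :=
  IsNoetherianRing R ∧ ∀ m : Ideal R, m.IsMaximal → idealGrade m = m.height

/-- A weighted oriented graph is Cohen-Macaulay over the field `K` if the quotient of the polynomial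
ring by its edge ideal is a Cohen-Macaulay ring. -/
def WeightedOrientedGraph.IsCohenMacaulay {V : Type u} (D : WeightedOrientedGraph V)
    (K : Type v) [Field K] : Prop :=
  IsCohenMacaulayRing (MvPolynomial V K ⧸ D.edgeIdeal K)

/-! Since every edge at `z` points into `z`, splitting off that variable gives `I(H) = I(G) +
f·(N)`, where `f = z ^ w(z)` and `N` is the set of neighbours of `z`. Modulo `I(G)`, `f` is a
nonzerodivisor, so `(I(H) : f) = I(G) + (N)` and `I(H) + (f) = I(G) + (f)`. The depth lemma
`HasDepth.of_colon_of_sup` thus bounds the depth of `I(H)` below by the depths of these two ideals.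

Let `n` be the number of variables other than `z` and `c = ht I(G)`. Adjoining `z` raises depth by
one (`hasDepth_map_C_of_forall`), and dividing by `f` then costs one, so `I(G) + (f)` has depth at
least `n - c`. The quotient by `I(G) + (N)` is that of `F` with `z` adjoined; as `ht I(F) + |N| ≤ c
+ 1`, its depth is also at least `n - c`. Finally `ht I(H) ≥ c + 1`: a cover of `H` either contains
`z`, leaving a cover of `G`, or contains `N`, where the height hypothesis applies. Hence the
dimension is at most `n - c`, and depth equals dimension.

Cohen–Macaulayness is tested at all maximal ideals, not only at the origin. `HasVarPrimes.hasDepth`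
provides a uniform depth bound, because minimal primes of these ideals are generated by variables
and so have polynomial quotients. -/

/-! ### Depth of quotients through weakly regular sequences -/

section DepthTheory

variable {R : Type*} [CommRing R]

/-- `x` is a nonzerodivisor modulo the ideal `I`. -/
def RegularMod (I : Ideal R) (x : R) : Prop := ∀ a, x * a ∈ I → a ∈ I

/-- `HasDepth M d I`: there are `d` elements of `M` forming a weakly regular sequence on `R ⧸ I`. -/
def HasDepth (M : Ideal R) : ℕ → Ideal R → Prop
  | 0, _ => True
  | d + 1, I => ∃ x ∈ M, RegularMod I x ∧ HasDepth M d (I ⊔ Ideal.span {x})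

theorem mem_sup_span_iff {I : Ideal R} {x a : R} :
    a ∈ I ⊔ Ideal.span {x} ↔ ∃ b, a - x * b ∈ I := by
  constructor
  · intro h
    obtain ⟨i, hi, y, hy, rfl⟩ := Submodule.mem_sup.1 h
    obtain ⟨b, rfl⟩ := Ideal.mem_span_singleton'.1 hy
    exact ⟨b, by simpa [mul_comm x b] using hi⟩
  · rintro ⟨b, hb⟩
    have h : x * b ∈ Ideal.span {x} := Ideal.mul_mem_right _ _ (Ideal.mem_span_singleton_self x)
    have := (I ⊔ Ideal.span {x}).add_mem (Ideal.mem_sup_left hb) (Ideal.mem_sup_right h)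
    simpa using this

theorem regularMod_top (x : R) : RegularMod (⊤ : Ideal R) x := fun _ _ => trivial

theorem hasDepth_top (M : Ideal R) (d : ℕ) : HasDepth M d ⊤ := by
  induction d with
  | zero => trivial
  | succ d ih => exact ⟨0, M.zero_mem, regularMod_top 0, by rwa [top_sup_eq]⟩

/-- Sequences are only weakly regular, so the bound is vacuous away from the support of `R ⧸ I`: an
element of `M` congruent to 1 modulo `I` is regular and leaves the zero quotient. -/
theorem hasDepth_of_sup_eq_top {M I : Ideal R} (h : M ⊔ I = ⊤) (d : ℕ) : HasDepth M d I := by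
  cases d with
  | zero => trivial
  | succ d =>
    obtain ⟨x, hx, i, hi, hxi⟩ := Submodule.mem_sup.1 ((Ideal.eq_top_iff_one _).1 h)
    refine ⟨x, hx, fun a ha => ?_, ?_⟩
    · have : a = x * a + i * a := by rw [← add_mul, hxi, one_mul]
      rw [this]
      exact I.add_mem ha (I.mul_mem_right _ hi)
    · have : I ⊔ Ideal.span {x} = ⊤ := by
        rw [Ideal.eq_top_iff_one, mem_sup_span_iff]
        exact ⟨1, by rwa [show (1 : R) - x * 1 = i by linear_combination -hxi]⟩
      rw [this]
      exact hasDepth_top M d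

theorem HasDepth.of_succ {M : Ideal R} {d : ℕ} : ∀ {I : Ideal R},
    HasDepth M (d + 1) I → HasDepth M d I := by
  induction d with
  | zero => intros; trivial
  | succ d ih =>
    rintro I ⟨x, hx, hreg, h⟩
    exact ⟨x, hx, hreg, ih h⟩

theorem HasDepth.mono {M : Ideal R} {d e : ℕ} {I : Ideal R} (h : HasDepth M e I) (hde : d ≤ e) :
    HasDepth M d I := by
  induction e, hde using Nat.le_induction with
  | base => exact h
  | succ e _ ih => exact ih h.of_succ

theorem regularMod_comap_iff {S : Type*} [CommRing S] {φ : R →+* S}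
    (hφ : Function.Surjective φ) {I : Ideal S} {x : R} :
    RegularMod (I.comap φ) x ↔ RegularMod I (φ x) := by
  constructor
  · intro h a ha
    obtain ⟨a, rfl⟩ := hφ a
    exact h a (by simpa [Ideal.mem_comap] using ha)
  · intro h a ha
    exact h (φ a) (by simpa [Ideal.mem_comap] using ha)

theorem comap_sup_span {S : Type*} [CommRing S] {φ : R →+* S}
    (hφ : Function.Surjective φ) (I : Ideal S) (x : R) :
    (I ⊔ Ideal.span {φ x}).comap φ = I.comap φ ⊔ Ideal.span {x} := by
  ext a
  rw [Ideal.mem_comap, mem_sup_span_iff, mem_sup_span_iff]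
  constructor
  · rintro ⟨b, hb⟩
    obtain ⟨b, rfl⟩ := hφ b
    exact ⟨b, by simpa [Ideal.mem_comap] using hb⟩
  · rintro ⟨b, hb⟩
    exact ⟨φ b, by simpa [Ideal.mem_comap] using hb⟩

theorem hasDepth_comap_iff {S : Type*} [CommRing S] {φ : R →+* S}
    (hφ : Function.Surjective φ) (M : Ideal S) {d : ℕ} : ∀ {I : Ideal S},
    HasDepth (M.comap φ) d (I.comap φ) ↔ HasDepth M d I := by
  induction d with
  | zero => intros; exact Iff.rfl
  | succ d ih =>
    intro I
    constructor
    · rintro ⟨x, hx, hreg, h⟩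
      rw [← comap_sup_span hφ, ih] at h
      exact ⟨φ x, hx, (regularMod_comap_iff hφ).1 hreg, h⟩
    · rintro ⟨x, hx, hreg, h⟩
      obtain ⟨x, rfl⟩ := hφ x
      rw [← ih, comap_sup_span hφ] at h
      exact ⟨x, hx, (regularMod_comap_iff hφ).2 hreg, h⟩

theorem exists_mem_associatedPrimes_of_not_regularMod [IsNoetherianRing R] {I : Ideal R} {x : R}
    (h : ¬ RegularMod I x) : ∃ P ∈ associatedPrimes R (R ⧸ I), x ∈ P := by
  simp only [RegularMod, not_forall] at h
  obtain ⟨a, hxa, ha⟩ := h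
  have : x ∈ ⋃ p ∈ associatedPrimes R (R ⧸ I), (p : Set R) := by
    rw [biUnion_associatedPrimes_eq_zero_divisors]
    refine ⟨Ideal.Quotient.mk I a, by rwa [Ne, Ideal.Quotient.eq_zero_iff_mem], ?_⟩
    rw [← Ideal.Quotient.mk_eq_mk, ← Submodule.Quotient.mk_smul, Ideal.Quotient.mk_eq_mk,
      Ideal.Quotient.eq_zero_iff_mem]
    exact hxa
  simpa using this

theorem exists_mul_mem_of_mem_associatedPrimes [IsNoetherianRing R] {I P : Ideal R}
    (h : P ∈ associatedPrimes R (R ⧸ I)) : ∃ u ∉ I, ∀ a ∈ P, a * u ∈ I := by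
  rw [AssociatedPrimes.mem_iff, isAssociatedPrime_iff] at h
  obtain ⟨hP, u, rfl⟩ := h
  obtain ⟨u, rfl⟩ := Ideal.Quotient.mk_surjective u
  refine ⟨u, fun hu => hP.ne_top ?_, fun a ha => ?_⟩
  · rw [Ideal.Quotient.eq_zero_iff_mem.2 hu, Ideal.eq_top_iff_one]
    simp
  · rw [Submodule.mem_colon_singleton, ← Ideal.Quotient.mk_eq_mk, ← Submodule.Quotient.mk_smul,
      Ideal.Quotient.mk_eq_mk, Submodule.mem_bot, Ideal.Quotient.eq_zero_iff_mem] at ha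
    exact ha

/-- Prime avoidance: if no element of `M` is regular modulo all the ideals of a finite family, then
`M` kills a nonzero element modulo one of them. -/
theorem exists_common_regularMod [IsNoetherianRing R] (M : Ideal R) (s : Finset (Ideal R))
    (h : ∀ I ∈ s, ∀ u, (∀ a ∈ M, a * u ∈ I) → u ∈ I) : ∃ x ∈ M, ∀ I ∈ s, RegularMod I x := by
  by_contra! hcon
  have hfin : (⋃ I ∈ s, associatedPrimes R (R ⧸ I)).Finite :=
    s.finite_toSet.biUnion fun I _ => associatedPrimes.finite R (R ⧸ I)
  -- Prime avoidance exempts two indices from primality; the exemption is not needed, hence the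
  -- dummy values `0 0`.
  obtain ⟨P, hP, hMP⟩ := (M.subset_union_prime_finite hfin (f := id) 0 0 (fun P hP _ _ => by
      simp only [Set.mem_iUnion] at hP
      obtain ⟨I, _, hP⟩ := hP
      exact hP.isPrime)).1 (fun x hx => by
    obtain ⟨I, hI, hx⟩ := hcon x hx
    obtain ⟨P, hP, hxP⟩ := exists_mem_associatedPrimes_of_not_regularMod hx
    simp only [Set.mem_iUnion]
    exact ⟨P, ⟨I, hI, hP⟩, hxP⟩)
  simp only [Set.mem_iUnion] at hP
  obtain ⟨I, hI, hP⟩ := hP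
  obtain ⟨u, hu, hPu⟩ := exists_mul_mem_of_mem_associatedPrimes hP
  exact hu (h I hI u fun a ha => hPu a (hMP ha))

theorem HasDepth.mem_of_forall_mul_mem {M I : Ideal R} {d : ℕ} (h : HasDepth M (d + 1) I) (u : R)
    (hu : ∀ a ∈ M, a * u ∈ I) : u ∈ I := by
  obtain ⟨x, hx, hreg, _⟩ := h
  exact hreg u (hu x hx)

theorem RegularMod.swap {I : Ideal R} {x z : R}
    (hzx : RegularMod (I ⊔ Ideal.span {x}) z) (hx : RegularMod I x) :
    RegularMod (I ⊔ Ideal.span {z}) x := by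
  intro a ha
  obtain ⟨b, hb⟩ := mem_sup_span_iff.1 ha
  have hb' : b ∈ I ⊔ Ideal.span {x} := hzx b (mem_sup_span_iff.2 ⟨a, by
    have := I.neg_mem hb
    rwa [neg_sub] at this⟩)
  obtain ⟨c, hc⟩ := mem_sup_span_iff.1 hb'
  refine mem_sup_span_iff.2 ⟨c, hx _ ?_⟩
  have : x * (a - z * c) = (x * a - z * b) + z * (b - x * c) := by ring
  rw [this]
  exact I.add_mem hb (I.mul_mem_left _ hc)

/-- The length of a maximal regular sequence does not depend on its first element. -/
theorem HasDepth.sup_span_of_regularMod [IsNoetherianRing R] {M : Ideal R} {d : ℕ} :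
    ∀ {I : Ideal R} {y : R}, HasDepth M (d + 1) I → y ∈ M → RegularMod I y →
      HasDepth M d (I ⊔ Ideal.span {y}) := by
  induction d with
  | zero => intros; trivial
  | succ d ih =>
    intro I y hI hyM hy
    obtain ⟨x, hxM, hx, hIx⟩ := hI
    -- The part killed by `M` transfers between the quotients by `x` and by `y`: if `x u ≡ y v`
    -- modulo `I`, then `M` kills `v` modulo `I + (x)`, so `v` vanishes there, and cancelling `x`
    -- puts `u` in `I + (y)`.
    have hsoc : ∀ u, (∀ a ∈ M, a * u ∈ I ⊔ Ideal.span {y}) → u ∈ I ⊔ Ideal.span {y} := by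
      intro u hu
      obtain ⟨v, hv⟩ := mem_sup_span_iff.1 (hu x hxM)
      have hvx : v ∈ I ⊔ Ideal.span {x} := by
        refine hIx.mem_of_forall_mul_mem v fun a ha => ?_
        obtain ⟨w, hw⟩ := mem_sup_span_iff.1 (hu a ha)
        refine mem_sup_span_iff.2 ⟨w, hy _ ?_⟩
        have : y * (a * v - x * w) = x * (a * u - y * w) - a * (x * u - y * v) := by ring
        rw [this]
        exact I.sub_mem (I.mul_mem_left _ hw) (I.mul_mem_left _ hv)
      obtain ⟨t, ht⟩ := mem_sup_span_iff.1 hvx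
      refine mem_sup_span_iff.2 ⟨t, hx _ ?_⟩
      have : x * (u - y * t) = (x * u - y * v) + y * (v - x * t) := by ring
      rw [this]
      exact I.add_mem hv (I.mul_mem_left _ ht)
    classical
    obtain ⟨z, hzM, hz⟩ := exists_common_regularMod M
      {I ⊔ Ideal.span {x}, I ⊔ Ideal.span {y}} (by
        simp only [Finset.mem_insert, Finset.mem_singleton]
        rintro J (rfl | rfl)
        · exact hIx.mem_of_forall_mul_mem
        · exact hsoc)
    have hzx : RegularMod (I ⊔ Ideal.span {x}) z := hz _ (by simp)
    have hzy : RegularMod (I ⊔ Ideal.span {y}) z := hz _ (by simp)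
    -- Exchange `x` for `y` through `z`: strip `z` after `x`, put `x` back in front over `I + (z)`,
    -- then strip `y`.
    have h1 := ih hIx hzM hzx
    have h2 : HasDepth M (d + 1) (I ⊔ Ideal.span {z}) :=
      ⟨x, hxM, hzx.swap hx, by rwa [sup_right_comm]⟩
    have h3 := ih h2 hyM (hzy.swap hy)
    exact ⟨z, hzM, hzy, by rwa [sup_right_comm]⟩

/-- The depth lemma for `0 → R ⧸ (I : f) → R ⧸ I → R ⧸ (I + f) → 0`, with `J = (I : f)`. -/
theorem HasDepth.of_colon_of_sup [IsNoetherianRing R] {M : Ideal R} {f : R} {d : ℕ} :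
    ∀ {I J : Ideal R}, (∀ a, a ∈ J ↔ f * a ∈ I) → HasDepth M d J →
      HasDepth M d (I ⊔ Ideal.span {f}) → HasDepth M d I := by
  induction d with
  | zero => intros; trivial
  | succ d ih =>
    intro I J hJ h1 h2
    classical
    obtain ⟨x, hxM, hx⟩ := exists_common_regularMod M {J, I ⊔ Ideal.span {f}} (by
        simp only [Finset.mem_insert, Finset.mem_singleton]
        rintro J (rfl | rfl)
        · exact h1.mem_of_forall_mul_mem
        · exact h2.mem_of_forall_mul_mem)
    have hx1 : RegularMod J x := hx _ (by simp)
    have hx2 : RegularMod (I ⊔ Ideal.span {f}) x := hx _ (by simp)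
    refine ⟨x, hxM, fun a ha => ?_, ih (J := J ⊔ Ideal.span {x}) (fun a => ?_)
      (h1.sup_span_of_regularMod hxM hx1) ?_⟩
    · obtain ⟨b, hb⟩ := mem_sup_span_iff.1 (hx2 a (Ideal.mem_sup_left ha))
      have hbJ : b ∈ J := hx1 b ((hJ _).2 (by
        have : f * (x * b) = x * a - x * (a - f * b) := by ring
        rw [this]
        exact I.sub_mem ha (I.mul_mem_left _ hb)))
      have := I.add_mem hb ((hJ b).1 hbJ)
      simpa using this
    -- The colon relation survives reduction modulo `x` because `x` is regular modulo `I + (f)`.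
    · rw [mem_sup_span_iff, mem_sup_span_iff]
      constructor
      · rintro ⟨b, hb⟩
        refine ⟨f * b, ?_⟩
        have := (hJ _).1 hb
        rwa [mul_sub, mul_left_comm] at this
      · rintro ⟨b, hb⟩
        obtain ⟨c, hc⟩ := mem_sup_span_iff.1 (hx2 b (mem_sup_span_iff.2 ⟨a, by
          have := I.neg_mem hb
          rwa [neg_sub] at this⟩))
        refine ⟨c, (hJ _).2 ?_⟩
        have : f * (a - x * c) = (f * a - x * b) + x * (b - f * c) := by ring
        rw [this]
        exact I.add_mem hb (I.mul_mem_left _ hc)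
    · rw [sup_right_comm]
      exact h2.sup_span_of_regularMod hxM hx2

end DepthTheory

/-! ### Depth against height, and the Cohen–Macaulay criterion -/

section Grade

variable {R : Type*} [CommRing R]

/-- An associated prime `P ≤ M` of `R ⧸ I` is contained, together with a given element `x` of `M`
that is regular modulo `I`, in an associated prime `Q ≤ M` of `R ⧸ (I + x)`. -/
theorem exists_colon_prime_sup_span [IsNoetherianRing R] {M I P : Ideal R} [M.IsPrime]
    {x : R} (hxM : x ∈ M) (hx : RegularMod I x) (hPM : P ≤ M) {u : R}
    (hu : P = I.colon {u}) :
    ∃ Q : Ideal R, Q.IsPrime ∧ (∃ v, Q = (I ⊔ Ideal.span {x}).colon {v}) ∧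
      P ≤ Q ∧ x ∈ Q ∧ Q ≤ M := by
  have hmem : ∀ (J : Ideal R) (a b : R), a ∈ J.colon {b} ↔ a * b ∈ J := fun J a b => by
    rw [Submodule.mem_colon_singleton, smul_eq_mul]
  let L : Ideal R := I.colon (P : Set R)
  have hL : ∀ a, a ∈ L ↔ ∀ p ∈ P, a * p ∈ I := fun a => by
    simp only [L, Submodule.mem_colon, smul_eq_mul, SetLike.mem_coe]
  have huL : u ∈ L := (hL u).2 fun p hp => by
    rw [hu, hmem] at hp
    rwa [mul_comm]
  obtain ⟨a, haL, ha⟩ : ∃ a ∈ L, ∀ s ∉ M, s * a ∉ I ⊔ Ideal.span {x} := by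
    by_contra! hcon
    -- As `L` is finitely generated, one product of the multipliers serves all of `L`.
    obtain ⟨s, hsM, hs⟩ : ∃ s ∉ M, ∀ a ∈ L, s * a ∈ I ⊔ Ideal.span {x} := by
      obtain ⟨T, hT⟩ := (isNoetherianRing_iff_ideal_fg R).1 inferInstance L
      choose! t htM ht using hcon
      refine ⟨∏ i ∈ T, t i, ?_, ?_⟩
      · have : (∏ i ∈ T, t i) ∈ M.primeCompl := by
          refine Submonoid.prod_mem _ fun i hi => htM i ?_
          rw [← hT]
          exact Ideal.subset_span hi
        exact this
      · have : L ≤ (I ⊔ Ideal.span {x}).colon {∏ i ∈ T, t i} := by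
          rw [← hT, Ideal.span_le]
          intro i hi
          obtain ⟨w, hw⟩ := Finset.dvd_prod_of_mem t hi
          rw [SetLike.mem_coe, hmem, hw, ← mul_assoc, mul_comm i]
          refine Ideal.mul_mem_right _ _ (ht i ?_)
          rw [← hT]
          exact Ideal.subset_span hi
        intro a ha
        have := this ha
        rwa [hmem, mul_comm] at this
    let N : Submodule R (R ⧸ I) := Submodule.map I.mkQ L
    have hN : ∀ n : N, ∃ a ∈ L, I.mkQ a = n := fun n => n.2
    let f : Module.End R N := s • LinearMap.id
    -- Regularity of `x` forces the quotient `b` back into `L`, so `s` maps `L ⧸ I` into `x` times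
    -- itself.
    have hf : LinearMap.range f ≤ Ideal.span {x} • (⊤ : Submodule R N) := by
      rintro _ ⟨n, rfl⟩
      obtain ⟨a, haL, han⟩ := hN n
      obtain ⟨b, hb⟩ := mem_sup_span_iff.1 (hs a haL)
      have hbL : b ∈ L := (hL b).2 fun p hp => hx _ (by
        have : x * (b * p) = s * (a * p) - (s * a - x * b) * p := by ring
        rw [this]
        exact I.sub_mem (I.mul_mem_left _ ((hL a).1 haL p hp)) (I.mul_mem_right _ hb))
      have : f n = x • (⟨I.mkQ b, b, hbL, rfl⟩ : N) := by
        ext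
        simp only [f, LinearMap.smul_apply, LinearMap.id_apply, Submodule.coe_smul, ← han,
          ← map_smul, smul_eq_mul]
        rw [← sub_eq_zero, ← map_sub]
        exact (Submodule.Quotient.mk_eq_zero I).2 hb
      rw [this]
      exact Submodule.smul_mem_smul (Ideal.mem_span_singleton_self x) trivial
    -- Cayley–Hamilton: `p(s)` kills `u`, so it lies in `P ≤ M`. All lower coefficients lie in `(x)
    -- ≤ M`, which leaves a power of `s` in `M`, a contradiction.
    obtain ⟨p, hp, hdeg, hcoeff, hp0⟩ :=
      LinearMap.exists_monic_and_natDegree_eq_and_coeff_mem_pow_and_aeval_eq_zero R f _ hf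
    have heval : p.eval s ∈ P := by
      rw [hu, hmem]
      have h1 : Polynomial.aeval f p = (p.eval s) • (LinearMap.id : Module.End R N) := by
        have : f = algebraMap R (Module.End R N) s := rfl
        rw [this, Polynomial.aeval_algebraMap_apply]
        rfl
      have h2 := congrArg (fun g : Module.End R N => g ⟨I.mkQ u, u, huL, rfl⟩) (h1.symm.trans hp0)
      have h3 := congrArg Subtype.val h2
      simp only [LinearMap.smul_apply, LinearMap.id_apply, Submodule.coe_smul,
        LinearMap.zero_apply, Submodule.coe_zero, ← map_smul, smul_eq_mul] at h3
      exact (Submodule.Quotient.mk_eq_zero I).1 h3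
    have hpow : s ^ p.natDegree ∈ M := by
      have h1 := hPM heval
      rw [Polynomial.eval_eq_sum_range, Finset.sum_range_succ, hp.coeff_natDegree, one_mul] at h1
      refine (M.add_mem_iff_right (M.sum_mem fun i hi => M.mul_mem_right _ ?_)).1 h1
      have h2 := hcoeff i
      rw [Finset.mem_range] at hi
      have h3 := Ideal.pow_le_self (I := Ideal.span {x}) (by omega : p.natDegree - i ≠ 0)
        (by convert h2)
      exact (Ideal.span_singleton_le_iff_mem M).2 hxM h3
    exact hsM (Ideal.IsPrime.mem_of_pow_mem ‹_› _ hpow)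
  have hcolon : (I ⊔ Ideal.span {x}).colon {a} ≤ M := fun s hs => by
    by_contra hsM
    exact ha s hsM ((hmem _ _ _).1 hs)
  obtain ⟨Q, hQ, hQM⟩ := Ideal.exists_minimalPrimes_le hcolon
  refine ⟨Q, hQ.1.1, Submodule.exists_eq_colon_of_mem_minimalPrimes hQ, ?_, ?_, hQM⟩
  · refine le_trans (fun p hp => (hmem _ _ _).2 ?_) hQ.1.2
    rw [mul_comm]
    exact Ideal.mem_sup_left ((hL a).1 haL p hp)
  · exact hQ.1.2 ((hmem _ _ _).2 (mem_sup_span_iff.2 ⟨a, by simp⟩))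

/-- Depth is bounded by the dimension of every associated component. -/
theorem HasDepth.height_add_le [IsNoetherianRing R] {M : Ideal R} [M.IsPrime] {d : ℕ} :
    ∀ {I P : Ideal R} [P.IsPrime], HasDepth M d I → P ≤ M → (∃ u, P = I.colon {u}) →
      P.height + d ≤ M.height := by
  induction d with
  | zero =>
    intro I P _ _ hPM _
    simpa using Ideal.height_mono hPM
  | succ d ih =>
    rintro I P hP ⟨x, hxM, hx, h⟩ hPM ⟨u, hu⟩
    obtain ⟨Q, hQ, hQI, hPQ, hxQ, hQM⟩ := exists_colon_prime_sup_span hxM hx hPM hu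
    have hxP : x ∉ P := fun hxP => hP.ne_top (by
      rw [hu, Submodule.mem_colon_singleton, smul_eq_mul] at hxP
      have := hx u hxP
      rw [hu, Ideal.eq_top_iff_one, Submodule.mem_colon_singleton, one_smul]
      exact this)
    have hlt : P < Q := lt_of_le_of_ne hPQ fun h => hxP (h ▸ hxQ)
    calc P.height + (d + 1 : ℕ) = (P.height + 1) + d := by push_cast; ring
      _ ≤ Q.height + d := by gcongr; exact Ideal.height_add_one_le_of_lt_of_isPrime hlt
      _ ≤ M.height := ih h hQM hQI

theorem HasDepth.height_add_le_of_mem_minimalPrimes [IsNoetherianRing R] {M I P : Ideal R}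
    [M.IsPrime] {d : ℕ} (h : HasDepth M d I) (hP : P ∈ I.minimalPrimes) (hPM : P ≤ M) :
    P.height + d ≤ M.height := by
  have := hP.1.1
  refine h.height_add_le hPM (Submodule.exists_eq_colon_of_mem_minimalPrimes (x := (1 : R)) ?_)
  have : I.colon {(1 : R)} = I := by
    ext a
    rw [Submodule.mem_colon_singleton, smul_eq_mul, mul_one]
  rwa [this]

theorem HasDepth.le_height [IsNoetherianRing R] {M : Ideal R} [M.IsPrime] {d : ℕ}
    (h : HasDepth M d ⊥) : (d : ℕ∞) ≤ M.height := by
  obtain ⟨P, hP, hPM⟩ := Ideal.exists_minimalPrimes_le (bot_le : ⊥ ≤ M)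
  exact le_add_self.trans (h.height_add_le_of_mem_minimalPrimes hP hPM)

theorem isSMulRegular_quotient_iff {I : Ideal R} {x : R} :
    IsSMulRegular (R ⧸ I) x ↔ RegularMod I x := by
  rw [isSMulRegular_iff_right_eq_zero_of_smul]
  constructor
  · intro h a ha
    rw [← Ideal.Quotient.eq_zero_iff_mem]
    refine h _ ?_
    rw [← Ideal.Quotient.mk_eq_mk, ← Submodule.Quotient.mk_smul, Ideal.Quotient.mk_eq_mk,
      Ideal.Quotient.eq_zero_iff_mem]
    exact ha
  · intro h a ha
    obtain ⟨a, rfl⟩ := Ideal.Quotient.mk_surjective a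
    rw [← Ideal.Quotient.mk_eq_mk, ← Submodule.Quotient.mk_smul, Ideal.Quotient.mk_eq_mk,
      Ideal.Quotient.eq_zero_iff_mem] at ha
    rw [Ideal.Quotient.eq_zero_iff_mem]
    exact h a ha

theorem hasDepth_iff_exists_list {M : Ideal R} {d : ℕ} : ∀ {I : Ideal R},
    HasDepth M d I ↔ ∃ rs : List R, rs.length = d ∧ (∀ r ∈ rs, r ∈ M) ∧
      ∀ i (h : i < rs.length), RegularMod (I ⊔ Ideal.ofList (rs.take i)) rs[i] := by
  induction d with
  | zero =>
    intro I
    exact ⟨fun _ => ⟨[], by simp⟩, fun _ => trivial⟩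
  | succ d ih =>
    intro I
    constructor
    · rintro ⟨x, hxM, hx, h⟩
      obtain ⟨rs, hlen, hM, hreg⟩ := ih.1 h
      refine ⟨x :: rs, by simp [hlen], by simpa using ⟨hxM, hM⟩, ?_⟩
      rintro (_ | i) hi
      · simpa using hx
      · simpa [sup_assoc] using hreg i (by simpa using hi)
    · rintro ⟨_ | ⟨x, rs⟩, hlen, hM, hreg⟩
      · simp at hlen
      · refine ⟨x, hM x (by simp), ?_, ih.2
          ⟨rs, by simpa using hlen, fun r hr => hM r (by simp [hr]), fun i hi => ?_⟩⟩
        swap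
        · have := hreg (i + 1) (by simpa using hi)
          rw [List.take_succ_cons, Ideal.ofList_cons, ← sup_assoc] at this
          exact this
        · have := hreg 0 (by simp)
          rw [List.take_zero, Ideal.ofList_nil, sup_bot_eq] at this
          exact this

/-- Elements of a proper ideal cannot generate the unit ideal, so weak regularity is already
regularity. -/
theorem hasDepth_bot_iff_exists_isRegular {M : Ideal R} (hM : M ≠ ⊤) {d : ℕ} :
    HasDepth M d ⊥ ↔ ∃ rs : List R, rs.length = d ∧ (∀ r ∈ rs, r ∈ M) ∧
      RingTheory.Sequence.IsRegular R rs := by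
  rw [hasDepth_iff_exists_list]
  refine exists_congr fun rs => and_congr_right fun _ => and_congr_right fun hrs => ?_
  rw [RingTheory.Sequence.isRegular_iff, RingTheory.Sequence.isWeaklyRegular_iff]
  simp only [smul_eq_mul, Ideal.mul_top, bot_sup_eq, isSMulRegular_quotient_iff]
  refine (and_iff_left ?_).symm
  intro h
  refine hM (top_le_iff.1 (h.le.trans (Ideal.span_le.2 hrs)))

theorem idealGrade_eq_height_iff [IsNoetherianRing R] {M : Ideal R} [M.IsPrime] {d : ℕ}
    (hd : M.height = d) : idealGrade M = M.height ↔ HasDepth M d ⊥ := by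
  have hM : M ≠ ⊤ := Ideal.IsPrime.ne_top ‹_›
  constructor
  · intro h
    cases d with
    | zero => trivial
    | succ d =>
      have hlt : (d : ℕ∞) < idealGrade M := by
        rw [h, hd]
        exact_mod_cast Nat.lt_succ_self d
      obtain ⟨rs, hlt⟩ := lt_iSup_iff.1 hlt
      obtain ⟨hrs, hlt⟩ := lt_iSup_iff.1 hlt
      refine ((hasDepth_bot_iff_exists_isRegular hM).2 ⟨rs, rfl, hrs⟩).mono ?_
      exact_mod_cast hlt
  · intro h
    refine le_antisymm (iSup₂_le fun rs hrs => ?_) ?_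
    · exact ((hasDepth_bot_iff_exists_isRegular hM).2 ⟨rs, rfl, hrs⟩).le_height
    · obtain ⟨rs, hlen, hrs⟩ := (hasDepth_bot_iff_exists_isRegular hM).1 h
      rw [hd, ← hlen]
      exact le_iSup₂_of_le rs hrs le_rfl

theorem isCohenMacaulayRing_quotient_iff [IsNoetherianRing R] {I : Ideal R} :
    IsCohenMacaulayRing (R ⧸ I) ↔ ∀ M : Ideal R, M.IsMaximal → I ≤ M → ∀ d : ℕ,
      (M.map (Ideal.Quotient.mk I)).height = d → HasDepth M d I := by
  have hsurj := Ideal.Quotient.mk_surjective (I := I)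
  have hker : (⊥ : Ideal (R ⧸ I)).comap (Ideal.Quotient.mk I) = I := by
    rw [← RingHom.ker_eq_comap_bot, Ideal.mk_ker]
  constructor
  · rintro ⟨_, h⟩ M hM hIM d hd
    have hmax : (M.map (Ideal.Quotient.mk I)).IsMaximal := by
      refine Ideal.IsMaximal.map_of_surjective_of_ker_le hsurj ?_
      rwa [Ideal.mk_ker]
    have hcomap : (M.map (Ideal.Quotient.mk I)).comap (Ideal.Quotient.mk I) = M :=
      Ideal.comap_map_mk hIM
    have := (idealGrade_eq_height_iff hd).1 (h _ hmax)
    rwa [← hasDepth_comap_iff hsurj, hcomap, hker] at this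
  · intro h
    refine ⟨inferInstance, fun m hm => ?_⟩
    have hfin : m.height ≠ ⊤ := Ideal.height_ne_top hm.ne_top
    obtain ⟨d, hd⟩ := ENat.ne_top_iff_exists.1 hfin
    rw [idealGrade_eq_height_iff hd.symm, ← hasDepth_comap_iff hsurj, hker]
    refine h _ (Ideal.comap_isMaximal_of_surjective _ hsurj) ?_ d ?_
    · exact hker.symm.le.trans (Ideal.comap_mono bot_le)
    · rw [Ideal.map_comap_of_surjective _ hsurj, hd]

/-- Pull back a chain of primes of `S` below `q`; its lowest term contains `I`, so the chain extends
downwards by `I.height` steps. -/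
theorem height_add_le_height_comap {S : Type*} [CommRing S] {φ : R →+* S}
    (hφ : Function.Surjective φ) {I : Ideal R} (hI : I ≤ RingHom.ker φ) {d : ℕ} :
    ∀ {q : Ideal S} [q.IsPrime], (d : ℕ∞) ≤ q.height → I.height + d ≤ (q.comap φ).height := by
  induction d with
  | zero =>
    intro q _ _
    simpa using Ideal.height_mono (hI.trans (Ideal.comap_mono bot_le))
  | succ d ih =>
    intro q hq hd
    obtain ⟨q', hq', hlt, hd'⟩ : ∃ q' : Ideal S, q'.IsPrime ∧ q' < q ∧ (d : ℕ∞) ≤ q'.height := by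
      by_contra! hcon
      have := hd.trans (Ideal.height_le_iff.2 fun q' hq' hlt => hcon q' hq' hlt)
      exact absurd this (by exact_mod_cast Nat.not_succ_le_self d)
    have hlt' : q'.comap φ < q.comap φ := by
      refine lt_of_le_of_ne (Ideal.comap_mono hlt.le) fun h => hlt.ne ?_
      exact Ideal.comap_injective_of_surjective φ hφ h
    calc I.height + (d + 1 : ℕ) = (I.height + d) + 1 := by push_cast; ring
      _ ≤ (q'.comap φ).height + 1 := by gcongr; exact ih hd'
      _ ≤ (q.comap φ).height := Ideal.height_add_one_le_of_lt_of_isPrime hlt'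

end Grade

/-! ### Adjoining one variable -/

section PolynomialExtension

open Polynomial

variable {A : Type*} [CommRing A]

theorem RegularMod.map_C {I : Ideal A} {x : A} (h : RegularMod I x) :
    RegularMod (I.map (C : A →+* A[X])) (C x) := by
  intro f hf
  rw [Ideal.mem_map_C_iff] at hf ⊢
  intro n
  exact h _ (by simpa using hf n)

theorem Polynomial.Monic.regularMod_map_C {f : A[X]} (hf : f.Monic) (I : Ideal A) :
    RegularMod (I.map (C : A →+* A[X])) f := by
  intro g hg
  have hker : I.map (C : A →+* A[X]) = RingHom.ker (mapRingHom (Ideal.Quotient.mk I)) := by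
    rw [ker_mapRingHom, Ideal.mk_ker]
  rw [hker, RingHom.mem_ker] at hg ⊢
  rw [map_mul] at hg
  exact ((hf.map (Ideal.Quotient.mk I)).mul_right_eq_zero_iff).1 hg

/-- The monic `f` goes last in the sequence, since it is regular modulo every extended ideal. -/
theorem HasDepth.map_C {m : Ideal A} {M : Ideal A[X]} (hmM : m ≤ M.comap C) {f : A[X]}
    (hfM : f ∈ M) (hf : f.Monic) {d : ℕ} : ∀ {I : Ideal A}, HasDepth m d I →
      HasDepth M (d + 1) (I.map (C : A →+* A[X])) := by
  induction d with
  | zero =>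
    intro I _
    exact ⟨f, hfM, hf.regularMod_map_C I, trivial⟩
  | succ d ih =>
    rintro I ⟨x, hxm, hx, h⟩
    refine ⟨C x, hmM hxm, hx.map_C, ?_⟩
    have := ih h
    rwa [Ideal.map_sup, Ideal.map_span, Set.image_singleton] at this

/-- By the Nullstellensatz for Jacobson rings, the class of `X` modulo `M` is integral over `A`. -/
theorem exists_monic_mem_of_isMaximal [IsJacobsonRing A] (M : Ideal A[X]) [M.IsMaximal] :
    ∃ f ∈ M, f.Monic := by
  obtain ⟨f, hf, h⟩ := quotient_mk_comp_C_isIntegral_of_isJacobsonRing M (Ideal.Quotient.mk M X)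
  refine ⟨f, ?_, hf⟩
  rw [← hom_eval₂, eval₂_C_X, Ideal.Quotient.eq_zero_iff_mem] at h
  exact h

theorem hasDepth_map_C_of_forall [IsJacobsonRing A] {I : Ideal A} {d : ℕ}
    (h : ∀ m : Ideal A, m.IsMaximal → HasDepth m d I) (M : Ideal A[X]) (hM : M.IsMaximal) :
    HasDepth M (d + 1) (I.map (C : A →+* A[X])) := by
  obtain ⟨f, hfM, hf⟩ := exists_monic_mem_of_isMaximal M
  exact (h _ (isMaximal_comap_C_of_isJacobsonRing M)).map_C le_rfl hfM hf

theorem hasDepth_of_not_le {M I : Ideal A} (hM : M.IsMaximal) (h : ¬ I ≤ M) (d : ℕ) :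
    HasDepth M d I := by
  refine hasDepth_of_sup_eq_top ?_ d
  by_contra hne
  exact h (le_sup_right.trans (hM.eq_of_le hne le_sup_left).ge)

theorem hasDepth_comap_of_forall {S : Type*} [CommRing S] {φ : A →+* S}
    (hφ : Function.Surjective φ) {I : Ideal S} {d : ℕ}
    (h : ∀ m : Ideal S, m.IsMaximal → HasDepth m d I) (M : Ideal A) (hM : M.IsMaximal) :
    HasDepth M d (I.comap φ) := by
  by_cases hker : RingHom.ker φ ≤ M
  · have hcomap : (M.map φ).comap φ = M := by
      rwa [Ideal.comap_map_of_surjective _ hφ, ← RingHom.ker_eq_comap_bot, sup_eq_left]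
    have := h _ (Ideal.IsMaximal.map_of_surjective_of_ker_le hφ hker)
    rwa [← hasDepth_comap_iff hφ, hcomap] at this
  · exact hasDepth_of_not_le hM (fun hle => hker ((Ideal.comap_mono bot_le).trans hle)) d

/-- Polynomial rings over fields have full depth at every maximal ideal. -/
theorem MvPolynomial.hasDepth_bot {K : Type v} [Field K] (σ : Type u) [Finite σ] :
    ∀ M : Ideal (MvPolynomial σ K), M.IsMaximal → HasDepth M (Nat.card σ) ⊥ := by
  have hbot : ∀ {R S : Type (max u v)} [CommRing R] [CommRing S] (e : R ≃+* S),
      (⊥ : Ideal S).comap (e : R →+* S) = ⊥ := fun e => by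
    ext a
    simp [Ideal.mem_comap]
  induction σ using Finite.induction_empty_option with
  | of_equiv e h =>
    intro M hM
    rw [← Nat.card_congr e, ← hbot (renameEquiv K e).symm.toRingEquiv]
    exact hasDepth_comap_of_forall (RingEquiv.surjective _) h M hM
  | h_empty =>
    intro M _
    rw [Nat.card_eq_fintype_card, Fintype.card_pempty]
    trivial
  | h_option h =>
    intro M hM
    rw [Finite.card_option, ← hbot (optionEquivLeft K _).toRingEquiv]
    refine hasDepth_comap_of_forall (RingEquiv.surjective _) (fun m hm => ?_) M hM
    have := hasDepth_map_C_of_forall h m hm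
    rwa [Ideal.map_bot] at this

theorem MvPolynomial.height_le_card {K : Type*} [Field K] {σ : Type*} [Finite σ]
    {M : Ideal (MvPolynomial σ K)} (hM : M ≠ ⊤) : M.height ≤ Nat.card σ := by
  have h := Ideal.height_le_ringKrullDim_of_ne_top hM
  rw [MvPolynomial.ringKrullDim_of_isNoetherianRing, ringKrullDim_eq_zero_of_field, zero_add] at h
  exact_mod_cast h

end PolynomialExtension

/-! ### Ideals generated by variables and unmixedness -/

section VariableIdeals

open MvPolynomial

variable {σ : Type u} (K : Type v) [Field K]

/-- The prime ideal generated by the variables in `C`. -/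
noncomputable def varIdeal (C : Set σ) : Ideal (MvPolynomial σ K) :=
  Ideal.span ((fun x => (X x : MvPolynomial σ K)) '' C)

/-- The map setting the variables in `C` to zero. -/
noncomputable def killVars (C : Set σ) : MvPolynomial σ K →+* MvPolynomial {x // x ∉ C} K :=
  (killCompl (R := K) (Subtype.val_injective (p := fun x => x ∉ C))).toRingHom

variable {K}

theorem X_mem_varIdeal {C : Set σ} {x : σ} (hx : x ∈ C) : X x ∈ varIdeal K C :=
  Ideal.subset_span ⟨x, hx, rfl⟩

theorem varIdeal_le_iff {C : Set σ} {I : Ideal (MvPolynomial σ K)} :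
    varIdeal K C ≤ I ↔ ∀ x ∈ C, X x ∈ I := by
  rw [varIdeal, Ideal.span_le, Set.image_subset_iff]
  rfl

theorem varIdeal_mono {C C' : Set σ} (h : C ⊆ C') : varIdeal K C ≤ varIdeal K C' :=
  varIdeal_le_iff.2 fun _ hx => X_mem_varIdeal (h hx)

theorem killVars_rename (C : Set σ) (p : MvPolynomial {x // x ∉ C} K) :
    killVars K C (rename Subtype.val p) = p :=
  killCompl_rename_app _ p

theorem killVars_surjective (C : Set σ) : Function.Surjective (killVars K C) :=
  fun p => ⟨_, killVars_rename C p⟩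

theorem killVars_X_of_mem {C : Set σ} {x : σ} (hx : x ∈ C) : killVars K C (X x) = 0 := by
  simp [killVars, killCompl, hx]

theorem killVars_X_of_notMem {C : Set σ} {x : σ} (hx : x ∉ C) :
    killVars K C (X x) = X ⟨x, hx⟩ := by
  have := killVars_rename (K := K) C (X ⟨x, hx⟩)
  rwa [rename_X] at this

theorem ker_killVars (C : Set σ) : RingHom.ker (killVars K C) = varIdeal K C := by
  refine le_antisymm (fun p hp => ?_) (varIdeal_le_iff.2 fun x hx => killVars_X_of_mem hx)
  have h : (Ideal.Quotient.mkₐ K (varIdeal K C)).comp ((rename Subtype.val).comp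
      (killCompl (R := K) (Subtype.val_injective (p := fun x => x ∉ C)))) =
      Ideal.Quotient.mkₐ K (varIdeal K C) := by
    refine algHom_ext fun x => ?_
    change Ideal.Quotient.mk _ (rename _ (killVars K C (X x))) = Ideal.Quotient.mk _ (X x)
    by_cases hx : x ∈ C
    · rw [killVars_X_of_mem hx, map_zero, map_zero, eq_comm, Ideal.Quotient.eq_zero_iff_mem]
      exact X_mem_varIdeal hx
    · rw [killVars_X_of_notMem hx, rename_X]
  have hp' : Ideal.Quotient.mk _ (rename Subtype.val (killVars K C p)) =
      Ideal.Quotient.mk (varIdeal K C) p := DFunLike.congr_fun h p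
  rw [RingHom.mem_ker.1 hp, map_zero, map_zero, eq_comm, Ideal.Quotient.eq_zero_iff_mem] at hp'
  exact hp'

instance varIdeal_isPrime (C : Set σ) : (varIdeal K C).IsPrime := by
  rw [← ker_killVars]
  exact RingHom.ker_isPrime _

theorem X_mem_varIdeal_iff {C : Set σ} {x : σ} : X x ∈ varIdeal K C ↔ x ∈ C := by
  refine ⟨fun h => ?_, X_mem_varIdeal⟩
  by_contra hx
  rw [← ker_killVars, RingHom.mem_ker, killVars_X_of_notMem hx] at h
  exact X_ne_zero _ h

/-- `HasVarPrimes J`: every prime containing `J` contains an ideal generated by variables that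
contains `J`. This holds for all monomial ideals. -/
def HasVarPrimes (J : Ideal (MvPolynomial σ K)) : Prop :=
  ∀ P : Ideal (MvPolynomial σ K), P.IsPrime → J ≤ P → J ≤ varIdeal K {x | X x ∈ P}

theorem HasVarPrimes.eq_varIdeal {J P : Ideal (MvPolynomial σ K)} (hJ : HasVarPrimes J)
    (hP : P ∈ J.minimalPrimes) : P = varIdeal K {x | X x ∈ P} := by
  have hle : varIdeal K {x | X x ∈ P} ≤ P := varIdeal_le_iff.2 fun x hx => hx
  exact le_antisymm (hP.2 ⟨inferInstance, hJ P hP.1.1 hP.1.2⟩ hle) hle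

variable [Finite σ]

theorem ncard_le_height_varIdeal (C : Set σ) : (C.ncard : ℕ∞) ≤ (varIdeal K C).height := by
  induction C, C.toFinite using Set.Finite.induction_on with
  | empty => simp
  | @insert a s ha hs ih =>
    rw [Set.ncard_insert_of_notMem ha hs]
    have hlt : varIdeal K s < varIdeal K (insert a s) := by
      refine lt_of_le_of_ne (varIdeal_mono (Set.subset_insert a s)) fun h => ha ?_
      rw [← X_mem_varIdeal_iff (K := K), h]
      exact X_mem_varIdeal (Set.mem_insert a s)
    push_cast
    exact (by gcongr : (s.ncard : ℕ∞) + 1 ≤ _).trans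
      (Ideal.height_add_one_le_of_lt_of_isPrime hlt)

theorem height_varIdeal_le_ncard (C : Set σ) : (varIdeal K C).height ≤ C.ncard := by
  have h := Ideal.height_le_card_of_mem_minimalPrimes_span (p := varIdeal K C)
    (s := (fun x => (X x : MvPolynomial σ K)) '' C) (C.toFinite.image _) (by
      change _ ∈ (varIdeal K C).minimalPrimes
      rw [Ideal.minimalPrimes_eq_subsingleton_self]
      rfl)
  refine h.trans ?_
  exact_mod_cast Set.ncard_image_le

theorem height_le_ncard_of_le_varIdeal {J : Ideal (MvPolynomial σ K)} {C : Set σ}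
    (h : J ≤ varIdeal K C) : J.height ≤ C.ncard :=
  (Ideal.height_mono h).trans (height_varIdeal_le_ncard C)

/-- Take a prime realising the height and keep only the variables it contains. -/
theorem HasVarPrimes.exists_ncard_le_height {J : Ideal (MvPolynomial σ K)} (hJ : HasVarPrimes J)
    (hJtop : J ≠ ⊤) : ∃ C : Set σ, J ≤ varIdeal K C ∧ (C.ncard : ℕ∞) ≤ J.height := by
  obtain ⟨c, hc⟩ := ENat.ne_top_iff_exists.1 (Ideal.height_ne_top hJtop)
  obtain ⟨P, hP, hJP, hPc⟩ := Ideal.exists_isPrime_height_eq hc.symm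
  refine ⟨_, hJ P hP hJP, (ncard_le_height_varIdeal (K := K) _).trans ?_⟩
  rw [← hc, ← hPc]
  exact Ideal.height_mono (varIdeal_le_iff.2 fun x hx => hx)

theorem hasDepth_varIdeal (C : Set σ) (M : Ideal (MvPolynomial σ K)) (hM : M.IsMaximal) :
    HasDepth M (Nat.card σ - C.ncard) (varIdeal K C) := by
  have hcard : Nat.card {x // x ∉ C} = Nat.card σ - C.ncard := by
    rw [← Set.ncard_compl]
    rfl
  rw [← ker_killVars, RingHom.ker_eq_comap_bot, ← hcard]
  exact hasDepth_comap_of_forall (killVars_surjective C) (MvPolynomial.hasDepth_bot _) M hM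

/-- The quotient by the variables in `C` is a polynomial ring of full depth, which bounds the height
of `M` modulo `J` below; Cohen–Macaulayness turns that height into depth. -/
theorem hasDepth_of_le_varIdeal {J M : Ideal (MvPolynomial σ K)} {C : Set σ}
    (hCM : IsCohenMacaulayRing (MvPolynomial σ K ⧸ J)) (hM : M.IsMaximal)
    (hJ : J ≤ varIdeal K C) (hC : varIdeal K C ≤ M) :
    HasDepth M (Nat.card σ - C.ncard) J := by
  have hsurj := Ideal.Quotient.mk_surjective (I := J)
  have hmap : (M.map (Ideal.Quotient.mk J)).IsMaximal := by
    refine Ideal.IsMaximal.map_of_surjective_of_ker_le hsurj ?_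
    rw [Ideal.mk_ker]
    exact hJ.trans hC
  have hprime : ((varIdeal K C).map (Ideal.Quotient.mk J)).IsPrime := by
    refine Ideal.map_isPrime_of_surjective hsurj ?_
    rwa [Ideal.mk_ker]
  obtain ⟨d, hd⟩ := ENat.ne_top_iff_exists.1 (Ideal.height_ne_top hmap.ne_top)
  refine (isCohenMacaulayRing_quotient_iff.1 hCM M hM (hJ.trans hC) d hd.symm).mono ?_
  have h := hasDepth_varIdeal C M hM
  rw [← Ideal.comap_map_mk hJ, ← Ideal.comap_map_mk (hJ.trans hC), hasDepth_comap_iff hsurj] at h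
  have := h.height_add_le_of_mem_minimalPrimes (P := (varIdeal K C).map (Ideal.Quotient.mk J)) (by
    rw [Ideal.minimalPrimes_eq_subsingleton_self]
    rfl) (Ideal.map_mono hC)
  rw [← hd] at this
  exact_mod_cast le_add_self.trans this

/-- A Cohen--Macaulay monomial quotient has the expected depth at every maximal ideal. -/
theorem HasVarPrimes.hasDepth {J : Ideal (MvPolynomial σ K)} (hJ : HasVarPrimes J)
    (hJtop : J ≠ ⊤) (hCM : IsCohenMacaulayRing (MvPolynomial σ K ⧸ J)) {c : ℕ}
    (hc : J.height = c) (M : Ideal (MvPolynomial σ K)) (hM : M.IsMaximal) :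
    HasDepth M (Nat.card σ - c) J := by
  by_cases hJM : J ≤ M
  swap
  · exact hasDepth_of_not_le hM hJM _
  -- The origin contains every ideal generated by variables, so depth there controls all minimal
  -- primes at once.
  let M₀ : Ideal (MvPolynomial σ K) := RingHom.ker (constantCoeff (R := K) (σ := σ))
  have hM₀ : M₀.IsMaximal :=
    RingHom.ker_isMaximal_of_surjective _ fun a => ⟨C a, constantCoeff_C σ a⟩
  have hvar : ∀ C, varIdeal K C ≤ M₀ := fun C =>
    varIdeal_le_iff.2 fun x _ => RingHom.mem_ker.2 (constantCoeff_X K x)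
  obtain ⟨C₀, hJC₀, hC₀⟩ := hJ.exists_ncard_le_height hJtop
  rw [hc] at hC₀
  have hdepth : HasDepth M₀ (Nat.card σ - c) J :=
    (hasDepth_of_le_varIdeal hCM hM₀ hJC₀ (hvar _)).mono
      (Nat.sub_le_sub_left (by exact_mod_cast hC₀) _)
  obtain ⟨P, hP, hPM⟩ := Ideal.exists_minimalPrimes_le hJM
  have hPC := hJ.eq_varIdeal hP
  rw [hPC] at hP
  rw [hPC] at hPM
  -- Unmixedness: the depth at the origin forces every minimal prime to use at most `c` variables,
  -- in particular the one below `M`.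
  have h1 := hdepth.height_add_le_of_mem_minimalPrimes hP (hvar _)
  have h2 := (add_le_add_left (ncard_le_height_varIdeal (K := K) _) _).trans
    (h1.trans (MvPolynomial.height_le_card hM₀.ne_top))
  refine (hasDepth_of_le_varIdeal hCM hM hP.1.2 hPM).mono ?_
  norm_cast at h2
  omega

end VariableIdeals

/-! ### Cohen–Macaulayness from a uniform depth bound -/

section VariableIdeals

open MvPolynomial

variable {σ : Type u} {K : Type v} [Field K]

theorem ncard_preimage_val (S C : Set σ) :
    ((Subtype.val ⁻¹' C : Set {x // x ∉ S})).ncard = (C \ S).ncard := by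
  rw [← Set.ncard_image_of_injective _ Subtype.val_injective]
  congr 1
  ext x
  simp [and_comm]

/-- The height of `M` modulo `J` is at most `Nat.card σ - J.height ≤ d`, so depth `d` suffices. -/
theorem isCohenMacaulayRing_of_hasDepth [Finite σ] {J : Ideal (MvPolynomial σ K)} {d : ℕ}
    (h : ∀ M : Ideal (MvPolynomial σ K), M.IsMaximal → HasDepth M d J)
    (hd : (Nat.card σ : ℕ∞) ≤ J.height + d) :
    IsCohenMacaulayRing (MvPolynomial σ K ⧸ J) := by
  refine isCohenMacaulayRing_quotient_iff.2 fun M hM hJM e he => (h M hM).mono ?_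
  have hsurj := Ideal.Quotient.mk_surjective (I := J)
  have hmap : (M.map (Ideal.Quotient.mk J)).IsMaximal :=
    Ideal.IsMaximal.map_of_surjective_of_ker_le hsurj (by rwa [Ideal.mk_ker])
  have h1 := height_add_le_height_comap hsurj (I := J) (by rw [Ideal.mk_ker]) he.ge
  rw [Ideal.comap_map_mk hJM] at h1
  have h2 := h1.trans ((MvPolynomial.height_le_card hM.ne_top).trans hd)
  have hJ : J.height ≠ ⊤ := Ideal.height_ne_top (ne_top_of_le_ne_top hM.ne_top hJM)
  exact_mod_cast (ENat.add_le_add_iff_left hJ).1 h2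

end VariableIdeals

/-! ### Edge ideals, vertex covers and vertex deletion -/

namespace WeightedOrientedGraph

open MvPolynomial

variable {V : Type u} {K : Type v} [Field K] {D : WeightedOrientedGraph V}

theorem generator_mem {x y : V} (h : D.Edge x y) :
    (X x * X y ^ D.weight y : MvPolynomial V K) ∈ D.edgeIdeal K :=
  Ideal.subset_span ⟨x, y, h, rfl⟩

theorem edgeIdeal_le_iff {I : Ideal (MvPolynomial V K)} :
    D.edgeIdeal K ≤ I ↔ ∀ x y, D.Edge x y → X x * X y ^ D.weight y ∈ I := by
  rw [edgeIdeal, Ideal.span_le]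
  constructor
  · intro h x y hxy
    exact h ⟨x, y, hxy, rfl⟩
  · rintro h _ ⟨x, y, hxy, rfl⟩
    exact h x y hxy

theorem edgeIdeal_le_prime_iff {P : Ideal (MvPolynomial V K)} [hP : P.IsPrime] :
    D.edgeIdeal K ≤ P ↔ ∀ x y, D.Edge x y → X x ∈ P ∨ X y ∈ P := by
  rw [edgeIdeal_le_iff]
  refine forall₃_congr fun x y _ => ?_
  rw [hP.mul_mem_iff_mem_or_mem, hP.pow_mem_iff_mem _ (D.weight_pos y)]

theorem edgeIdeal_le_varIdeal_iff {C : Set V} :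
    D.edgeIdeal K ≤ varIdeal K C ↔ ∀ x y, D.Edge x y → x ∈ C ∨ y ∈ C := by
  simp only [edgeIdeal_le_prime_iff, X_mem_varIdeal_iff]

theorem edgeIdeal_ne_top : D.edgeIdeal K ≠ ⊤ :=
  ne_top_of_le_ne_top (varIdeal_isPrime Set.univ).ne_top
    (edgeIdeal_le_varIdeal_iff.2 fun _ _ _ => Or.inl trivial)

theorem edgeIdeal_sup_varIdeal_ne_top (N : Set V) : D.edgeIdeal K ⊔ varIdeal K N ≠ ⊤ :=
  ne_top_of_le_ne_top (varIdeal_isPrime Set.univ).ne_top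
    (sup_le (edgeIdeal_le_varIdeal_iff.2 fun _ _ _ => Or.inl trivial)
      (varIdeal_mono (Set.subset_univ N)))

theorem hasVarPrimes_edgeIdeal : HasVarPrimes (D.edgeIdeal K) := fun _ _ hle =>
  edgeIdeal_le_varIdeal_iff.2 (edgeIdeal_le_prime_iff.1 hle)

theorem hasVarPrimes_edgeIdeal_sup (N : Set V) :
    HasVarPrimes (D.edgeIdeal K ⊔ varIdeal K N) := fun P hP hle =>
  sup_le (hasVarPrimes_edgeIdeal P hP (le_sup_left.trans hle))
    (varIdeal_mono (varIdeal_le_iff.1 (le_sup_right.trans hle)))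

/-- The edge ideal of `D \ N` is the image of the edge ideal of `D`. -/
theorem map_killVars_edgeIdeal (N : Set V) :
    (D.edgeIdeal K).map (killVars K N) = (D.deleteVerts N).edgeIdeal K := by
  refine le_antisymm ?_ ?_
  · rw [Ideal.map_le_iff_le_comap, edgeIdeal_le_iff]
    intro x y hxy
    rw [Ideal.mem_comap, map_mul, map_pow]
    by_cases hx : x ∈ N
    · simp [killVars_X_of_mem hx]
    by_cases hy : y ∈ N
    · simp [killVars_X_of_mem hy, (D.weight_pos y).ne']
    rw [killVars_X_of_notMem hx, killVars_X_of_notMem hy]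
    exact generator_mem (D := D.deleteVerts N) (x := ⟨x, hx⟩) (y := ⟨y, hy⟩) hxy
  · rw [edgeIdeal_le_iff]
    intro x y hxy
    have := Ideal.mem_map_of_mem (killVars K N) (generator_mem (D := D) (K := K) hxy)
    rwa [map_mul, map_pow, killVars_X_of_notMem x.2, killVars_X_of_notMem y.2] at this

theorem comap_killVars_edgeIdeal (N : Set V) :
    ((D.deleteVerts N).edgeIdeal K).comap (killVars K N) = D.edgeIdeal K ⊔ varIdeal K N := by
  rw [← map_killVars_edgeIdeal, Ideal.comap_map_of_surjective _ (killVars_surjective N),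
    ← RingHom.ker_eq_comap_bot, ker_killVars]

theorem IsCohenMacaulay.hasDepth [Finite V] (h : D.IsCohenMacaulay K) {c : ℕ}
    (hc : (D.edgeIdeal K).height = c) (M : Ideal (MvPolynomial V K)) (hM : M.IsMaximal) :
    HasDepth M (Nat.card V - c) (D.edgeIdeal K) :=
  hasVarPrimes_edgeIdeal.hasDepth edgeIdeal_ne_top h hc M hM

/-- A cover realising the height on the right contains `N`, and removing `N` leaves a cover of the
deletion. -/
theorem height_edgeIdeal_deleteVerts_add_le [Finite V] (N : Set V) :
    ((D.deleteVerts N).edgeIdeal K).height + N.ncard ≤ (D.edgeIdeal K ⊔ varIdeal K N).height := by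
  obtain ⟨C, hC, hCle⟩ := (hasVarPrimes_edgeIdeal_sup (D := D) (K := K) N).exists_ncard_le_height
    (edgeIdeal_sup_varIdeal_ne_top N)
  have hNC : N ⊆ C := fun x hx =>
    X_mem_varIdeal_iff.1 (varIdeal_le_iff.1 (le_sup_right.trans hC) x hx)
  have hcov := edgeIdeal_le_varIdeal_iff.1 (le_sup_left.trans hC)
  have hF : ((D.deleteVerts N).edgeIdeal K).height ≤ _ :=
    height_le_ncard_of_le_varIdeal (C := Subtype.val ⁻¹' C)
      (edgeIdeal_le_varIdeal_iff.2 fun x y hxy => hcov x y hxy)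
  rw [ncard_preimage_val] at hF
  refine le_trans ?_ hCle
  rw [← Set.ncard_sdiff_add_ncard_of_subset hNC]
  push_cast
  gcongr

/-- If `z` has no outgoing edges, deleting `z` lowers the height of the edge ideal. -/
theorem height_edgeIdeal_deleteVerts_add_one_le [Finite V] {z : V}
    (hheight : ((D.deleteVerts {z}).edgeIdeal K).height + 1 ≤
      ((D.deleteVerts {z}).edgeIdeal K ⊔ varIdeal K {x | D.Edge x.1 z}).height) :
    ((D.deleteVerts {z}).edgeIdeal K).height + 1 ≤ (D.edgeIdeal K).height := by
  obtain ⟨C, hC, hCle⟩ := (hasVarPrimes_edgeIdeal (D := D) (K := K)).exists_ncard_le_height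
    edgeIdeal_ne_top
  have hcov := edgeIdeal_le_varIdeal_iff.1 hC
  have hcov' : (D.deleteVerts {z}).edgeIdeal K ≤ varIdeal K (Subtype.val ⁻¹' C) :=
    edgeIdeal_le_varIdeal_iff.2 fun x y hxy => hcov x y hxy
  refine le_trans ?_ hCle
  -- Without `z`, the cover must contain every neighbour with an edge into `z`, so `hheight`
  -- applies.
  by_cases hz : z ∈ C
  · have := height_le_ncard_of_le_varIdeal hcov'
    rw [ncard_preimage_val] at this
    rw [← Set.ncard_sdiff_singleton_add_one hz]
    push_cast
    gcongr
  · refine hheight.trans ?_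
    have := height_le_ncard_of_le_varIdeal (sup_le hcov'
      (varIdeal_mono (K := K) (C := {x : {x : V // x ∉ ({z} : Set V)} | D.Edge x.1 z})
        fun x hx => (hcov x.1 z hx).resolve_right hz))
    rwa [ncard_preimage_val, Set.sdiff_singleton_eq_self hz] at this

/-- The isomorphism `K[V] ≃ K[V \ z][X]`, as a ring homomorphism. -/
noncomputable def splitVar (K : Type v) [Field K] (z : V) :
    MvPolynomial V K →+* Polynomial (MvPolynomial {x : V // x ∉ ({z} : Set V)} K) :=
  letI := Classical.decEq V
  (RingHomClass.toRingHom (optionEquivLeft K {x : V // x ≠ z})).comp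
    (RingHomClass.toRingHom (renameEquiv K (Equiv.optionSubtypeNe z).symm))

theorem splitVar_bijective (z : V) : Function.Bijective (splitVar K z) := by
  let := Classical.decEq V
  exact (optionEquivLeft K {x : V // x ≠ z}).bijective.comp
    (renameEquiv K (Equiv.optionSubtypeNe z).symm).bijective

theorem splitVar_X_self (z : V) : splitVar K z (X z) = Polynomial.X := by
  let := Classical.decEq V
  change optionEquivLeft K _ (rename (Equiv.optionSubtypeNe z).symm (X z)) = _
  rw [rename_X, Equiv.optionSubtypeNe_symm_self, optionEquivLeft_X_none]
  rfl

theorem splitVar_X_of_ne {z : V} (x : {x : V // x ∉ ({z} : Set V)}) :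
    splitVar K z (X x.1) = Polynomial.C (X x) := by
  let := Classical.decEq V
  have hx : x.1 ≠ z := x.2
  change optionEquivLeft K _ (rename (Equiv.optionSubtypeNe z).symm (X x.1)) = _
  rw [rename_X, Equiv.optionSubtypeNe_symm_of_ne hx, optionEquivLeft_X_some]
  rfl

theorem map_splitVar_edgeIdeal {z : V} (hz : ∀ x, ¬ D.Edge z x) :
    (D.edgeIdeal K).map (splitVar K z) =
      ((D.deleteVerts {z}).edgeIdeal K).map Polynomial.C ⊔
        (varIdeal K {x | D.Edge x.1 z}).map Polynomial.C *
          Ideal.span {Polynomial.X ^ D.weight z} := by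
  have hgen : ∀ x y : {x : V // x ∉ ({z} : Set V)},
      splitVar K z (X x.1 * X y.1 ^ D.weight y.1) =
        Polynomial.C (X x * X y ^ (D.deleteVerts {z}).weight y) := fun x y => by
    rw [map_mul, map_pow, splitVar_X_of_ne, splitVar_X_of_ne, map_mul, map_pow]
    rfl
  have hgen' : ∀ x : {x : V // x ∉ ({z} : Set V)},
      splitVar K z (X x.1 * X z ^ D.weight z) =
        Polynomial.C (X x) * Polynomial.X ^ D.weight z := fun x => by
    rw [map_mul, map_pow, splitVar_X_of_ne, splitVar_X_self]
  refine le_antisymm ?_ (sup_le ?_ ?_)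
  · rw [Ideal.map_le_iff_le_comap, edgeIdeal_le_iff]
    intro x y hxy
    have hx : x ∉ ({z} : Set V) := fun h => hz y (Set.mem_singleton_iff.1 h ▸ hxy)
    rw [Ideal.mem_comap]
    by_cases hy : y ∈ ({z} : Set V)
    · obtain rfl := Set.mem_singleton_iff.1 hy
      refine Ideal.mem_sup_right ?_
      rw [hgen' ⟨x, hx⟩]
      exact Ideal.mul_mem_mul (Ideal.mem_map_of_mem _ (X_mem_varIdeal hxy))
        (Ideal.mem_span_singleton_self _)
    · refine Ideal.mem_sup_left ?_
      rw [hgen ⟨x, hx⟩ ⟨y, hy⟩]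
      exact Ideal.mem_map_of_mem _ (generator_mem (D := D.deleteVerts {z}) (x := ⟨x, hx⟩)
        (y := ⟨y, hy⟩) hxy)
  · rw [Ideal.map_le_iff_le_comap, edgeIdeal_le_iff]
    intro x y hxy
    rw [Ideal.mem_comap, ← hgen]
    exact Ideal.mem_map_of_mem _ (generator_mem (D := D) hxy)
  · have : (varIdeal K {x | D.Edge x.1 z}).map Polynomial.C ≤
        ((D.edgeIdeal K).map (splitVar K z)).colon
          {(Polynomial.X ^ D.weight z : Polynomial (MvPolynomial _ K))} := by
      rw [Ideal.map_le_iff_le_comap, varIdeal_le_iff]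
      intro x hx
      rw [Ideal.mem_comap, Submodule.mem_colon_singleton, smul_eq_mul, ← hgen']
      exact Ideal.mem_map_of_mem _ (generator_mem (D := D) hx)
    rw [Ideal.mul_le]
    intro a ha b hb
    obtain ⟨b, rfl⟩ := Ideal.mem_span_singleton'.1 hb
    rw [mul_left_comm]
    exact Ideal.mul_mem_left _ _ (Submodule.mem_colon_singleton.1 (this ha))

end WeightedOrientedGraph

/-! ### The depth estimate for `I + f J` and the conclusion -/

/-- Depth of `R ⧸ (I + f J)` from the depths of `R ⧸ (I + J)` and `R ⧸ I`. -/
theorem HasDepth.sup_mul_span {R : Type*} [CommRing R] [IsNoetherianRing R] {M I J : Ideal R}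
    (hM : M.IsMaximal) {f : R} (hf : RegularMod I f) {d : ℕ} (hI : HasDepth M (d + 1) I)
    (hIJ : HasDepth M d (I ⊔ J)) : HasDepth M d (I ⊔ J * Ideal.span {f}) := by
  refine HasDepth.of_colon_of_sup (f := f) (J := I ⊔ J) (fun a => ?_) hIJ ?_
  · constructor
    · intro ha
      obtain ⟨i, hi, j, hj, rfl⟩ := Submodule.mem_sup.1 ha
      rw [mul_add, mul_comm f j]
      exact Submodule.add_mem_sup (I.mul_mem_left f hi)
        (Ideal.mul_mem_mul hj (Ideal.mem_span_singleton_self f))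
    · intro ha
      obtain ⟨i, hi, b, hb, hib⟩ := Submodule.mem_sup.1 ha
      obtain ⟨j, hj, rfl⟩ := Ideal.mem_mul_span_singleton.1 hb
      have : a - j ∈ I := hf _ (by
        rw [mul_sub, ← hib, mul_comm f j, add_sub_cancel_right]
        exact hi)
      have := Submodule.add_mem_sup this hj
      rwa [sub_add_cancel] at this
  · rw [sup_assoc, sup_eq_right.2 (Ideal.mul_le_right : J * Ideal.span {f} ≤ _)]
    -- A maximal ideal may miss `f`; the quotient by `f` is then trivial at `M`.
    by_cases hfM : f ∈ M
    · exact hI.sup_span_of_regularMod hfM hf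
    · exact hasDepth_of_not_le hM (fun h => hfM (h (Ideal.mem_sup_right
        (Ideal.mem_span_singleton_self f)))) d

open WeightedOrientedGraph in
theorem proposition3p8 {V : Type u} [Finite V] {K : Type v} [Field K]
    (H : WeightedOrientedGraph V) (z : V)
    (hz : ∀ x : V, ¬ H.Edge z x)
    (G : WeightedOrientedGraph {x : V // x ∉ ({z} : Set V)})
    (hG : G = H.deleteVerts {z})
    (N : Set {x : V // x ∉ ({z} : Set V)})
    (hN : N = {x | H.Edge x.1 z})
    (hcover : ¬ ∃ C : Set {x : V // x ∉ ({z} : Set V)},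
      Minimal (fun S => G.underlying.IsVertexCover S) C ∧ N ⊆ C)
    (hheight : (G.edgeIdeal K ⊔
        Ideal.span ((fun x => (MvPolynomial.X x : MvPolynomial _ K)) '' N)).height =
      (G.edgeIdeal K).height + 1)
    (hFCM : (G.deleteVerts N).IsCohenMacaulay K)
    (hGCM : G.IsCohenMacaulay K) :
    H.IsCohenMacaulay K := by
  change (G.edgeIdeal K ⊔ varIdeal K N).height = _ at hheight
  obtain ⟨c, hc⟩ := ENat.ne_top_iff_exists.1
    (Ideal.height_ne_top (edgeIdeal_ne_top (D := G) (K := K)))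
  obtain ⟨e, he⟩ := ENat.ne_top_iff_exists.1
    (Ideal.height_ne_top (edgeIdeal_ne_top (D := G.deleteVerts N) (K := K)))
  have hcardF : Nat.card {x // x ∉ N} = Nat.card {x : V // x ∉ ({z} : Set V)} - N.ncard := by
    rw [← Set.ncard_compl]
    rfl
  have hcardV : Nat.card V = Nat.card {x : V // x ∉ ({z} : Set V)} + 1 := by
    have := Set.ncard_add_ncard_compl ({z} : Set V)
    rw [Set.ncard_singleton, add_comm] at this
    exact this.symm
  have hle := height_edgeIdeal_deleteVerts_add_le (D := G) (K := K) N
  rw [hheight, ← hc, ← he] at hle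
  have hle' : e + N.ncard ≤ c + 1 := by exact_mod_cast hle
  have hHheight : (c : ℕ∞) + 1 ≤ (H.edgeIdeal K).height := by
    subst hG hN
    rw [hc]
    exact height_edgeIdeal_deleteVerts_add_one_le hheight.ge
  have hdepthF := hasDepth_map_C_of_forall (hasDepth_comap_of_forall (killVars_surjective N)
    (hFCM.hasDepth he.symm))
  rw [comap_killVars_edgeIdeal, Ideal.map_sup] at hdepthF
  have hdepthG := hasDepth_map_C_of_forall (hGCM.hasDepth hc.symm)
  have hdepth : ∀ M, M.IsMaximal → HasDepth M (Nat.card {x : V // x ∉ ({z} : Set V)} - c)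
      ((H.edgeIdeal K).map (splitVar K z)) := fun M hM => by
    rw [map_splitVar_edgeIdeal hz, ← hG, ← hN]
    exact HasDepth.sup_mul_span hM ((Polynomial.monic_X_pow _).regularMod_map_C _) (hdepthG M hM)
      -- The new variable offsets the `+ 1` in `hle'`: `n - |N| - e + 1 ≥ n - c`.
      ((hdepthF M hM).mono (by omega))
  refine isCohenMacaulayRing_of_hasDepth
    (d := Nat.card {x : V // x ∉ ({z} : Set V)} - c) (fun M hM => ?_) ?_
  · have := hasDepth_comap_of_forall (φ := (splitVar K z)) (splitVar_bijective z).surjective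
      hdepth M hM
    rwa [Ideal.comap_map_of_bijective _ (splitVar_bijective z)] at this
  · refine le_trans ?_ (add_le_add_left hHheight _)
    norm_cast
    omega
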